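/- Let $n\ge 1$ and let $\mathbb D^n=\{z\in\mathbb C^n:|z_j|<1,\ 1\le j\le n\}$. An inner function on $\mathbb D^n$ is a bounded holomorphic function $f$ on $\mathbb D^n$ such that $\lim_{r\to1^-}|f(rw)|=1$ for almost every $w$ in the torus $\mathbb T^n$; a rational inner function is an inner function that is the restriction of a rational function (a quotient of two polynomials). A nonconstant rational inner function $f$ is called irreducible if it cannot be written as $f=gh$ on $\mathbb D^n$ with rational inner functions $g,h$ that are both nonunits of the ring $\mathcal O(\mathbb D^n)$ of holomorphic functions on $\mathbb D^n$. For a polynomial $Q(z)=\sum_\alpha a_\alpha z^\alpha\in\mathbb C[z_1,\dots,z_n]$ let $\mathrm{supp}(Q)=\{\alpha: a_\alpha\ne0\}$, let $\nu(Q)=(\nu_1(Q),\dots,\nu_n(Q))$, where $\nu_j(Q)$ is the degree of $Q$ in the variable $z_j$, and let $z^{\nu(Q)}\widetilde Q(\tfrac1z)$ denote the polynomial $\sum_\alpha\overline{a_\alpha}\,z^{\nu(Q)-\alpha}$. The polynomial $Q$ is called deficient in degree if $\nu(Q)\notin\mathrm{supp}(Q)$. Let $f$ be an irreducible rational inner function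 on $\mathbb D^n$ with $f(0)=0$. Then there is a constant $c\in\mathbb C$ with $|c|=1$ such that either - $f(z)=c\,z_j$ on $\mathbb D^n$ for some $j\in\{1,\dots,n\}$, or - $f(z)=c\,\dfrac{z^{\nu(\mathcal Q)}\widetilde{\mathcal Q}(\frac1z)}{\mathcal Q(z)}$ on $\mathbb D^n$, where $\mathcal Q\in\mathbb C[z_1,\dots,z_n]$ is an irreducible polynomial that has no zeros in $\mathbb D^n$ and is deficient in degree. -/

import Mathlib

open Filter Topology MeasureTheory MvPolynomial
open scoped ComplexConjugate

namespace PolydiscInner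

/-- The open unit polydisc `𝔻ⁿ` in `ℂⁿ`. -/
def polydisc (n : ℕ) : Set (Fin n → ℂ) := {z | ∀ j, ‖z j‖ < 1}

/-- `f` belongs to the ring `𝒪(𝔻ⁿ)` of holomorphic functions on the polydisc. Only the values of
`f` on the polydisc matter. -/
def IsHolomorphic {n : ℕ} (f : (Fin n → ℂ) → ℂ) : Prop :=
  DifferentiableOn ℂ f (polydisc n)

/-- `f` is a unit of the ring `𝒪(𝔻ⁿ)`. -/
def IsHolomorphicUnit {n : ℕ} (f : (Fin n → ℂ) → ℂ) : Prop :=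
  IsHolomorphic f ∧ ∃ g : (Fin n → ℂ) → ℂ, IsHolomorphic g ∧ ∀ z ∈ polydisc n, f z * g z = 1

/-- `f` is an inner function on `𝔻ⁿ`: it belongs to `H^∞(𝔻ⁿ)` and its radial limits have modulus
`1` at almost every point `w` of the torus `𝕋ⁿ`. The torus is parametrized by
`θ ↦ torusMap 0 1 θ = (e^{iθ₁}, …, e^{iθₙ})`; since this map is periodic, a set of points of `𝕋ⁿ`
is null if and only if its preimage in `ℝⁿ` is Lebesgue null. -/
def IsInner {n : ℕ} (f : (Fin n → ℂ) → ℂ) : Prop :=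
  IsHolomorphic f ∧
  (∃ C : ℝ, ∀ z ∈ polydisc n, ‖f z‖ ≤ C) ∧
  ∀ᵐ θ : Fin n → ℝ,
    Tendsto (fun r : ℝ => ‖f (r • torusMap 0 1 θ)‖) (𝓝[<] 1) (𝓝 1)

/-- On `𝔻ⁿ`, `f` agrees with a rational function `P / Q`, `Q ≠ 0`. (The equation is multiplied
out, so that `Q` is not required to be free of zeros in `𝔻ⁿ`.) -/
def IsRational {n : ℕ} (f : (Fin n → ℂ) → ℂ) : Prop :=
  ∃ P Q : MvPolynomial (Fin n) ℂ, Q ≠ 0 ∧ ∀ z ∈ polydisc n, eval z Q * f z = eval z P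

/-- `f` is a rational inner function on `𝔻ⁿ`. -/
def IsRationalInner {n : ℕ} (f : (Fin n → ℂ) → ℂ) : Prop :=
  IsInner f ∧ IsRational f

/-- `f` is an irreducible (rational) inner function on `𝔻ⁿ`: it is a nonconstant rational inner
function which is not, on `𝔻ⁿ`, a product of two rational inner functions that are both nonunits
of `𝒪(𝔻ⁿ)`. -/
def IsIrreducibleInner {n : ℕ} (f : (Fin n → ℂ) → ℂ) : Prop :=
  IsRationalInner f ∧
  (¬ ∃ c : ℂ, ∀ z ∈ polydisc n, f z = c) ∧
  ¬ ∃ g h : (Fin n → ℂ) → ℂ,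
    IsRationalInner g ∧ IsRationalInner h ∧ ¬ IsHolomorphicUnit g ∧ ¬ IsHolomorphicUnit h ∧
    ∀ z ∈ polydisc n, f z = g z * h z

/-- The multi-index `ν(Q)`, whose `j`-th entry is the degree of `Q` in the variable `z_j`. -/
noncomputable def nu {n : ℕ} (Q : MvPolynomial (Fin n) ℂ) : Fin n →₀ ℕ :=
  Finsupp.equivFunOnFinite.symm fun j => Q.degreeOf j

/-- `Q` is deficient in degree: `ν(Q) ∉ supp(Q)`. -/
def DeficientInDegree {n : ℕ} (Q : MvPolynomial (Fin n) ℂ) : Prop :=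
  nu Q ∉ Q.support

/-- The polynomial `Q̃`, obtained from `Q` by conjugating its coefficients. -/
noncomputable def conjCoeff {n : ℕ} (Q : MvPolynomial (Fin n) ℂ) : MvPolynomial (Fin n) ℂ :=
  Q.map (starRingEnd ℂ)

/-- The polynomial `z^{ν(Q)} Q̃(1/z) = ∑_α conj(a_α) z^{ν(Q) - α}`, where `Q = ∑_α a_α z^α`. As
`α ≤ ν(Q)` for all `α ∈ supp(Q)`, the subtraction of multi-indices is never truncated. -/
noncomputable def reflection {n : ℕ} (Q : MvPolynomial (Fin n) ℂ) : MvPolynomial (Fin n) ℂ :=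
  ∑ α ∈ Q.support, monomial (nu Q - α) (conj (Q.coeff α))

/-- Where no coordinate vanishes, `reflection Q` takes the value `z^{ν(Q)} Q̃(1/z)`. -/
theorem eval_reflection {n : ℕ} (Q : MvPolynomial (Fin n) ℂ) (z : Fin n → ℂ)
    (hz : ∀ j, z j ≠ 0) :
    eval z (reflection Q) = (∏ j, z j ^ nu Q j) * eval (fun j => 1 / z j) (conjCoeff Q) := by
  rw [reflection, conjCoeff, eval_map, eval₂_eq', map_sum, Finset.mul_sum]
  refine Finset.sum_congr rfl fun α hα => ?_
  rw [eval_monomial, Finsupp.prod_fintype _ _ (by simp), mul_left_comm, ← Finset.prod_mul_distrib]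
  congr 1
  refine Finset.prod_congr rfl fun j _ => ?_
  have h : α j ≤ nu Q j := by
    simpa [nu] using monomial_le_degreeOf j hα
  rw [Finsupp.tsub_apply, pow_sub₀ _ (hz j) h, one_div, inv_pow]

end PolydiscInner

namespace PolydiscInner

variable {n : ℕ}

/-! Write `f = P / Q` in lowest terms. Holomorphy of `f` forces `P` to vanish wherever `Q` does in
the polydisc, so a zero of `Q` there would give an irreducible factor of `Q` dividing `P`
(`dvd_of_eventually_eval_eq_zero`); hence `Q` has no zeros in the polydisc. The radial limits and
continuity give `|P| = |Q|` on the torus.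

Let `*` denote `reflection`. On the torus `|P|² = |Q|²` becomes the polynomial identity `z^ν(Q) P P*
= z^ν(P) Q Q*`, and coprimality with a degree count gives Rudin's form `P = c z^β Q*` with `|c| = 1`
(`eq_monomial_mul_reflection`). Conversely, every such quotient with zero-free `Q` is rational
inner, by the maximum principle (`isRationalInner_of_reflection`).

Now `f(0) = 0` leaves two cases. If `β ≠ 0`, some `z_j` splits off. If `β = 0`, then `Q*(0) = 0`;
since reflection is multiplicative, some irreducible factor `q` of `Q` has `q*(0) = 0`, which is
deficiency in degree, and `q* / q` splits off. In both cases the factor vanishes at `0`, so by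
irreducibility the cofactor is a unit, and a rational inner unit is a unimodular constant
(`IsRationalInner.eq_const_of_isHolomorphicUnit`). -/

/-- The torus `𝕋ⁿ`. -/
def torus (n : ℕ) : Set (Fin n → ℂ) := {w | ∀ j, ‖w j‖ = 1}

/-! ### Polynomials on the torus and the reflection -/

theorem eq_of_eqOn_torus {P Q : MvPolynomial (Fin n) ℂ}
    (h : ∀ w ∈ torus n, eval w P = eval w Q) : P = Q := by
  have hinf : (Metric.sphere (0 : ℂ) 1).Infinite := by
    -- The points `exp(i/(k+1))` are distinct because their arguments `1/(k+1)` lie in `(-π, π]`.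
    refine Set.infinite_of_injective_forall_mem
      (f := fun k : ℕ => Complex.exp ((1 / (k + 1 : ℝ) : ℝ) * Complex.I)) ?_ ?_
    · intro k l hkl
      have hb : ∀ k : ℕ, (1 / (k + 1 : ℝ)) ∈ Set.Ioc (-Real.pi) Real.pi := fun k =>
        ⟨by linarith [Real.pi_pos, show (0 : ℝ) < 1 / (k + 1 : ℝ) by positivity],
         by
          have : (1 / (k + 1 : ℝ)) ≤ 1 := by
            rw [div_le_one (by positivity)]; linarith [Nat.cast_nonneg (α := ℝ) k]
          linarith [Real.pi_gt_three]⟩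
      have h1 := congrArg Complex.arg hkl
      simp only [Complex.arg_exp_mul_I] at h1
      rw [(toIocMod_eq_self _).2 (by simpa [two_mul, add_comm] using hb k),
        (toIocMod_eq_self _).2 (by simpa [two_mul, add_comm] using hb l)] at h1
      have := inv_injective (by simpa using h1 : ((k : ℝ) + 1)⁻¹ = ((l : ℝ) + 1)⁻¹)
      exact_mod_cast add_right_cancel this
    · intro k
      rw [mem_sphere_zero_iff_norm]
      exact Complex.norm_exp_ofReal_mul_I _
  exact funext_set (fun _ => Metric.sphere (0 : ℂ) 1) (fun _ => hinf)
    fun x hx => h x fun j => by simpa using hx j (Set.mem_univ _)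

theorem ne_zero_of_mem_torus {w : Fin n → ℂ} (hw : w ∈ torus n) (j : Fin n) : w j ≠ 0 :=
  norm_ne_zero_iff.1 (by rw [hw j]; exact one_ne_zero)

theorem norm_prod_pow_of_mem_torus {w : Fin n → ℂ} (hw : w ∈ torus n) (α : Fin n →₀ ℕ) :
    ‖∏ j, w j ^ α j‖ = 1 := by
  simp [hw _]

theorem eval_monomial_one (α : Fin n →₀ ℕ) (z : Fin n → ℂ) :
    eval z (monomial α (1 : ℂ)) = ∏ j, z j ^ α j := by
  rw [eval_monomial, Finsupp.prod_fintype _ _ (by simp), one_mul]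

theorem eval_conjCoeff (Q : MvPolynomial (Fin n) ℂ) (z : Fin n → ℂ) :
    eval (fun j => conj (z j)) (conjCoeff Q) = conj (eval z Q) := by
  rw [conjCoeff, eval_map]
  exact (eval₂_comp_left (starRingEnd ℂ) (RingHom.id ℂ) z Q).symm

theorem eval_reflection_eq_conj (Q : MvPolynomial (Fin n) ℂ) (z : Fin n → ℂ)
    (hz : ∀ j, z j ≠ 0) :
    eval z (reflection Q) =
      (∏ j, z j ^ nu Q j) * conj (eval (fun j => (conj (z j))⁻¹) Q) := by
  rw [eval_reflection Q z hz, ← eval_conjCoeff]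
  simp

theorem eval_reflection_of_mem_torus (Q : MvPolynomial (Fin n) ℂ) {w : Fin n → ℂ}
    (hw : w ∈ torus n) :
    eval w (reflection Q) = (∏ j, w j ^ nu Q j) * conj (eval w Q) := by
  rw [eval_reflection_eq_conj Q w (ne_zero_of_mem_torus hw)]
  congr 4
  funext j
  rw [Complex.inv_def, Complex.conj_conj, Complex.normSq_conj, Complex.normSq_eq_norm_sq, hw j]
  simp

theorem norm_eval_reflection_of_mem_torus (Q : MvPolynomial (Fin n) ℂ) {w : Fin n → ℂ}
    (hw : w ∈ torus n) : ‖eval w (reflection Q)‖ = ‖eval w Q‖ := by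
  rw [eval_reflection_of_mem_torus Q hw, norm_mul, norm_prod_pow_of_mem_torus hw, one_mul,
    RCLike.norm_conj]

theorem nu_apply (Q : MvPolynomial (Fin n) ℂ) (j : Fin n) : nu Q j = Q.degreeOf j := rfl

theorem nu_mul {P Q : MvPolynomial (Fin n) ℂ} (hP : P ≠ 0) (hQ : Q ≠ 0) :
    nu (P * Q) = nu P + nu Q := by
  ext j
  simp [nu_apply, degreeOf_mul_eq hP hQ]

theorem nu_monomial (α : Fin n →₀ ℕ) {a : ℂ} (ha : a ≠ 0) : nu (monomial α a) = α := by
  ext j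
  rw [nu_apply, degreeOf_monomial_eq _ _ ha]

theorem nu_reflection_le (Q : MvPolynomial (Fin n) ℂ) : nu (reflection Q) ≤ nu Q := by
  intro j
  rw [nu_apply, reflection]
  refine (degreeOf_sum_le _ _ _).trans (Finset.sup_le fun α hα => ?_)
  by_cases h : conj (Q.coeff α) = 0
  · simp [h]
  · rw [degreeOf_monomial_eq _ _ h]
    simp

/-- On the torus the reflection is `w^ν(Q)` times the conjugate of `Q(w)`, and `ν` is additive on
nonzero polynomials. -/
theorem reflection_mul {P Q : MvPolynomial (Fin n) ℂ} (hP : P ≠ 0) (hQ : Q ≠ 0) :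
    reflection (P * Q) = reflection P * reflection Q := by
  refine eq_of_eqOn_torus fun w hw => ?_
  rw [eval_mul, eval_reflection_of_mem_torus _ hw, eval_reflection_of_mem_torus _ hw,
    eval_reflection_of_mem_torus _ hw, nu_mul hP hQ, eval_mul, map_mul]
  simp only [Finsupp.add_apply, pow_add, Finset.prod_mul_distrib]
  ring

/-- Only `α = ν(Q)` contributes a constant term to the reflection. This turns deficiency in degree
into vanishing at the origin. -/
theorem eval_zero_reflection (Q : MvPolynomial (Fin n) ℂ) :
    eval 0 (reflection Q) = conj (Q.coeff (nu Q)) := by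
  have hle : ∀ α ∈ Q.support, α ≤ nu Q := fun α hα j => monomial_le_degreeOf j hα
  have : ∀ α ∈ Q.support, eval (0 : Fin n → ℂ) (monomial (nu Q - α) (conj (Q.coeff α))) =
      if α = nu Q then conj (Q.coeff (nu Q)) else 0 := by
    intro α hα
    split_ifs with h
    · simp [h]
    · have : nu Q - α ≠ 0 := fun h0 => h (le_antisymm (hle α hα) (tsub_eq_zero_iff_le.1 h0))
      obtain ⟨j, hj⟩ := Finsupp.ne_iff.1 this
      rw [eval_monomial, Finsupp.prod_fintype _ _ (by simp),
        Finset.prod_eq_zero (Finset.mem_univ j), mul_zero]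
      simpa using hj
  rw [reflection, map_sum, Finset.sum_congr rfl this, Finset.sum_ite_eq']
  split_ifs with h
  · rfl
  · simp [notMem_support_iff.1 h]

theorem deficientInDegree_iff (Q : MvPolynomial (Fin n) ℂ) :
    DeficientInDegree Q ↔ eval 0 (reflection Q) = 0 := by
  rw [eval_zero_reflection, DeficientInDegree, notMem_support_iff]
  simp

/-! ### Rudin's form of the numerator -/

/-- Two polynomials without common factor that have the same modulus on the torus. -/
theorem eq_monomial_mul_reflection {P Q : MvPolynomial (Fin n) ℂ} (hPQ : IsRelPrime P Q)
    (hQ0 : ∀ j, IsRelPrime Q (X j)) (hQ : Q ≠ 0)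
    (hT : ∀ w ∈ torus n, ‖eval w P‖ = ‖eval w Q‖) :
    ∃ (c : ℂ) (β : Fin n →₀ ℕ), ‖c‖ = 1 ∧ P = C c * monomial β 1 * reflection Q := by
  have hne : ∃ w ∈ torus n, eval w Q ≠ 0 := by
    by_contra! h
    exact hQ (eq_of_eqOn_torus fun w hw => by simpa using h w hw)
  obtain ⟨w₀, hw₀, hw₀Q⟩ := hne
  have hP : P ≠ 0 := by
    rintro rfl
    have := hT w₀ hw₀
    rw [map_zero, norm_zero] at this
    exact hw₀Q (norm_eq_zero.1 this.symm)
  have hid : monomial (nu Q) 1 * P * reflection P = monomial (nu P) 1 * Q * reflection Q := by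
    refine eq_of_eqOn_torus fun w hw => ?_
    simp only [eval_mul, eval_reflection_of_mem_torus _ hw, eval_monomial_one]
    have h : eval w P * conj (eval w P) = eval w Q * conj (eval w Q) := by
      rw [Complex.mul_conj, Complex.mul_conj, Complex.normSq_eq_norm_sq, hT w hw,
        ← Complex.normSq_eq_norm_sq]
    linear_combination (∏ j, w j ^ nu Q j) * (∏ j, w j ^ nu P j) * h
  have hmono : ∀ α : Fin n →₀ ℕ, IsRelPrime Q (monomial α (1 : ℂ)) := by
    intro α
    rw [monomial_eq, C_1, one_mul, Finsupp.prod_fintype _ _ (by simp)]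
    exact IsRelPrime.prod_right fun j _ => (hQ0 j).pow_right
  have hm : ∀ α : Fin n →₀ ℕ, monomial α (1 : ℂ) ≠ 0 := fun α => by simp
  obtain ⟨S, hS⟩ : Q ∣ reflection P := by
    have h1 : Q ∣ monomial (nu Q) 1 * P * reflection P := ⟨monomial (nu P) 1 * reflection Q, by
      rw [hid]; ring⟩
    exact ((hmono _).mul_right hPQ.symm).dvd_of_dvd_mul_left h1
  have hrP : reflection P ≠ 0 := by
    intro h
    have := norm_eval_reflection_of_mem_torus P hw₀
    rw [h, hT w₀ hw₀] at this
    rw [map_zero, norm_zero] at this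
    exact hw₀Q (norm_eq_zero.1 this.symm)
  have hS0 : S ≠ 0 := by
    rintro rfl
    simp [hS] at hrP
  have hid2 : monomial (nu Q) 1 * P * S = monomial (nu P) 1 * reflection Q := by
    apply mul_left_cancel₀ hQ
    rw [hS] at hid
    linear_combination hid
  have hrQ : reflection Q ≠ 0 := by
    rintro h
    rw [h, mul_zero] at hid2
    simp [hP, hS0] at hid2
  -- Comparing degrees in `hid2` gives `ν(Q) + ν(P) + ν(S) = ν(P) + ν(Q*)`, while `ν(Q*) ≤ ν(Q)`.
  have hνS : nu S = 0 := by
    have h := congrArg nu hid2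
    rw [nu_mul (mul_ne_zero (hm _) hP) hS0, nu_mul (hm _) hP, nu_mul (hm _) hrQ,
      nu_monomial _ one_ne_zero, nu_monomial _ one_ne_zero] at h
    ext j
    have hj := DFunLike.congr_fun h j
    have := nu_reflection_le Q j
    simp only [Finsupp.add_apply] at hj
    simp only [Finsupp.coe_zero, Pi.zero_apply]
    omega
  obtain ⟨s, rfl⟩ : ∃ s, S = C s := by
    refine ⟨S.coeff 0, ?_⟩
    ext m
    rw [coeff_C]
    split_ifs with h
    · rw [h]
    · by_contra hm
      refine h ?_
      ext j
      have h1 := monomial_le_degreeOf j (mem_support_iff.2 hm)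
      have h2 : S.degreeOf j = 0 := DFunLike.congr_fun hνS j
      simp only [Finsupp.coe_zero, Pi.zero_apply]
      omega
  have hs0 : s ≠ 0 := by rintro rfl; simp at hS0
  have hs : ‖s‖ = 1 := by
    have h := norm_eval_reflection_of_mem_torus P hw₀
    rw [hS, eval_mul, eval_C, norm_mul, hT w₀ hw₀] at h
    exact (mul_eq_left₀ (norm_ne_zero_iff.2 hw₀Q)).1 h
  have hle : nu Q ≤ nu P := by
    have h := nu_reflection_le P
    rw [hS, nu_mul hQ hS0, hνS, add_zero] at h
    exact h
  refine ⟨s⁻¹, nu P - nu Q, by rw [norm_inv, hs, inv_one], ?_⟩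
  apply mul_left_cancel₀ (mul_ne_zero (hm (nu Q)) hS0)
  have h3 : monomial (nu P) (1 : ℂ) = monomial (nu Q) 1 * monomial (nu P - nu Q) 1 := by
    rw [monomial_mul, one_mul, add_tsub_cancel_of_le hle]
  have h4 : (C s * C s⁻¹ : MvPolynomial (Fin n) ℂ) = 1 := by
    rw [← C_mul, mul_inv_cancel₀ hs0, C_1]
  rw [h3] at hid2
  linear_combination hid2 - monomial (nu Q) 1 * monomial (nu P - nu Q) 1 * reflection Q * h4

/-! ### A local Nullstellensatz for irreducible hypersurfaces -/

/-- Up to sign the constant term is the product of the roots. The lemma replaces continuity of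
roots. -/
theorem exists_isRoot_norm_lt {p : Polynomial ℂ} (hp : p.Monic) {ε : ℝ}
    (hε : 0 < ε) (h0 : ‖p.eval 0‖ < ε ^ p.natDegree) : ∃ t, p.IsRoot t ∧ ‖t‖ < ε := by
  by_contra! h
  have key : ∀ s : Multiset ℂ, (∀ x ∈ s, ε ≤ ‖x‖) → ε ^ s.card ≤ ‖s.prod‖ := by
    intro s
    induction s using Multiset.induction_on with
    | empty => simp
    | cons a s ih =>
      intro hs
      rw [Multiset.card_cons, Multiset.prod_cons, norm_mul, pow_succ']
      exact mul_le_mul (hs a (Multiset.mem_cons_self a s))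
        (ih fun x hx => hs x (Multiset.mem_cons_of_mem hx)) (by positivity) (norm_nonneg _)
  have hs := IsAlgClosed.splits p
  have h1 := key p.roots fun x hx => h x (Polynomial.isRoot_of_mem_roots hx)
  rw [← Polynomial.coeff_zero_eq_eval_zero, hs.coeff_zero_eq_prod_roots_of_monic hp, norm_mul,
    norm_pow, norm_neg, norm_one, one_pow, one_mul] at h0
  rw [← hs.natDegree_eq_card_roots] at h1
  linarith

/-- The polynomial `F(z + t v)` in the variable `t`. -/
noncomputable def lineHom (v : Fin n → ℂ) :
    MvPolynomial (Fin n) ℂ →+* Polynomial (MvPolynomial (Fin n) ℂ) :=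
  eval₂Hom (Polynomial.C.comp C)
    fun i => Polynomial.C (C (v i)) * Polynomial.X + Polynomial.C (X i)

/-- The substitution `z ↦ z + t v` in polynomials in `z` and `t`. -/
noncomputable def shear (v : Fin n → ℂ) :
    Polynomial (MvPolynomial (Fin n) ℂ) →+* Polynomial (MvPolynomial (Fin n) ℂ) :=
  Polynomial.eval₂RingHom (lineHom v) Polynomial.X

theorem shear_C (v : Fin n → ℂ) (F : MvPolynomial (Fin n) ℂ) :
    shear v (Polynomial.C F) = lineHom v F := by
  simp [shear]

theorem shear_neg_shear (v : Fin n → ℂ) (F : Polynomial (MvPolynomial (Fin n) ℂ)) :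
    shear (-v) (shear v F) = F := by
  have : (shear (-v)).comp (shear v) = RingHom.id _ := by
    refine Polynomial.ringHom_ext' (MvPolynomial.ringHom_ext (fun r => ?_) fun i => ?_) ?_
    · simp [shear, lineHom]
    · simp [shear, lineHom]
      ring
    · simp [shear]
  exact RingHom.congr_fun this F

theorem eval_eval_lineHom (v z : Fin n → ℂ) (t : ℂ) (F : MvPolynomial (Fin n) ℂ) :
    ((lineHom v F).map (eval z)).eval t = eval (z + t • v) F := by
  have : ((Polynomial.evalRingHom t).comp (Polynomial.mapRingHom (eval z))).comp (lineHom v) =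
      eval (z + t • v) := by
    refine MvPolynomial.ringHom_ext (fun r => ?_) fun i => ?_
    · simp [lineHom]
    · simp [lineHom]
      ring
  exact RingHom.congr_fun this F

theorem eval_zero_lineHom (v : Fin n → ℂ) (F : MvPolynomial (Fin n) ℂ) :
    (lineHom v F).eval 0 = F := by
  have : (Polynomial.evalRingHom 0).comp (lineHom v) = RingHom.id _ := by
    refine MvPolynomial.ringHom_ext (fun r => ?_) fun i => ?_
    · simp [lineHom]
    · simp [lineHom]
  exact RingHom.congr_fun this F

theorem dvd_of_lineHom_dvd {v : Fin n → ℂ} {F G : MvPolynomial (Fin n) ℂ}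
    (h : lineHom v F ∣ lineHom v G) : F ∣ G := by
  simpa [eval_zero_lineHom] using map_dvd (Polynomial.evalRingHom 0) h

/-- The shear is an automorphism of the polynomials in `z` and `t`, with inverse the shear along
`-v`, and it carries the prime constant polynomial `q` to `q(z + t v)`. -/
theorem prime_lineHom (v : Fin n → ℂ) {q : MvPolynomial (Fin n) ℂ} (hq : Prime q) :
    Prime (lineHom v q) := by
  rw [← shear_C]
  refine comap_prime (shear (-v)) (shear v) (fun F => ?_) ?_
  · simpa using shear_neg_shear (-v) F
  · rw [shear_neg_shear]
    exact Polynomial.prime_C_iff.2 hq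

theorem lineHom_monomial (v : Fin n → ℂ) (α : Fin n →₀ ℕ) (a : ℂ) :
    lineHom v (monomial α a) = Polynomial.C (C a) *
      ∏ i, (Polynomial.C (C (v i)) * Polynomial.X + Polynomial.C (X i)) ^ α i := by
  simp [lineHom, Finsupp.prod_fintype]

theorem natDegree_lineHom_monomial_le (v : Fin n → ℂ) (α : Fin n →₀ ℕ) (a : ℂ) :
    (lineHom v (monomial α a)).natDegree ≤ α.degree := by
  rw [lineHom_monomial, Finsupp.degree_eq_sum]
  refine (Polynomial.natDegree_C_mul_le _ _).trans
    ((Polynomial.natDegree_prod_le _ _).trans (Finset.sum_le_sum fun i _ => ?_))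
  refine Polynomial.natDegree_pow_le.trans ?_
  exact (Nat.mul_le_mul_left _ Polynomial.natDegree_linear_le).trans (by simp)

theorem coeff_lineHom_monomial (v : Fin n → ℂ) (α : Fin n →₀ ℕ) (a : ℂ) :
    (lineHom v (monomial α a)).coeff α.degree = C (eval v (monomial α a)) := by
  have key : ∀ s : Finset (Fin n),
      (∏ i ∈ s, (Polynomial.C (C (v i)) * Polynomial.X + Polynomial.C (X i)) ^ α i :
        Polynomial (MvPolynomial (Fin n) ℂ)).coeff (∑ i ∈ s, α i) = ∏ i ∈ s, C (v i) ^ α i := by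
    intro s
    induction s using Finset.induction_on with
    | empty => simp
    | insert i s hi ih =>
      rw [Finset.prod_insert hi, Finset.prod_insert hi, Finset.sum_insert hi,
        Polynomial.coeff_mul_add_eq_of_natDegree_le, ih]
      · congr 1
        have := Polynomial.coeff_pow_of_natDegree_le (m := α i) (n := 1)
          (p := Polynomial.C (C (v i)) * Polynomial.X + Polynomial.C (X i :
            MvPolynomial (Fin n) ℂ)) Polynomial.natDegree_linear_le
        rw [mul_one] at this
        rw [this]
        simp
      · refine Polynomial.natDegree_pow_le.trans ?_
        exact (Nat.mul_le_mul_left _ Polynomial.natDegree_linear_le).trans (by simp)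
      · refine (Polynomial.natDegree_prod_le _ _).trans (Finset.sum_le_sum fun i _ => ?_)
        refine Polynomial.natDegree_pow_le.trans ?_
        exact (Nat.mul_le_mul_left _ Polynomial.natDegree_linear_le).trans (by simp)
  rw [lineHom_monomial, Finsupp.degree_eq_sum, Polynomial.coeff_C_mul, key, eval_monomial,
    Finsupp.prod_fintype _ _ (by simp)]
  simp

theorem natDegree_lineHom_le (v : Fin n → ℂ) (F : MvPolynomial (Fin n) ℂ) :
    (lineHom v F).natDegree ≤ F.totalDegree := by
  conv_lhs => rw [F.as_sum, map_sum]
  refine Polynomial.natDegree_sum_le_of_forall_le _ _ fun α hα => ?_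
  refine (natDegree_lineHom_monomial_le v α _).trans ?_
  exact le_totalDegree hα

/-- The top coefficient in `t` does not involve `z`, so a direction `v` off the zero set of the
leading form makes `F(z + t v)` monic up to a scalar. -/
theorem coeff_lineHom_totalDegree (v : Fin n → ℂ) (F : MvPolynomial (Fin n) ℂ) :
    (lineHom v F).coeff F.totalDegree =
      C (eval v (homogeneousComponent F.totalDegree F)) := by
  conv_lhs => arg 1; rw [F.as_sum, map_sum]
  rw [Polynomial.finsetSum_coeff, homogeneousComponent_apply, map_sum, map_sum, Finset.sum_filter]
  refine Finset.sum_congr rfl fun α hα => ?_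
  split_ifs with h
  · rw [← h, coeff_lineHom_monomial]
  · refine Polynomial.coeff_eq_zero_of_natDegree_lt
      ((natDegree_lineHom_monomial_le v α _).trans_lt (lt_of_le_of_ne ?_ h))
    exact le_totalDegree hα

theorem homogeneousComponent_totalDegree_ne_zero {F : MvPolynomial (Fin n) ℂ} (hF : F ≠ 0) :
    homogeneousComponent F.totalDegree F ≠ 0 := by
  obtain ⟨α, hα, h⟩ := Finset.exists_mem_eq_sup F.support (support_nonempty.2 hF)
    fun s => s.sum fun _ e => e
  intro h0
  have := congrArg (coeff α) h0
  rw [coeff_homogeneousComponent, if_pos, coeff_zero] at this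
  · exact mem_support_iff.1 hα this
  · rw [totalDegree, h]
    rfl

theorem eq_zero_of_eventually_eval_eq_zero {F : MvPolynomial (Fin n) ℂ} {a : Fin n → ℂ}
    (h : ∀ᶠ z in 𝓝 a, eval z F = 0) : F = 0 := by
  obtain ⟨ε, hε, hball⟩ := Metric.eventually_nhds_iff.1 h
  refine funext_set (fun i => Metric.ball (a i) ε)
    (fun i => infinite_of_mem_nhds (a i) (Metric.ball_mem_nhds _ hε)) fun x hx => ?_
  rw [map_zero]
  exact hball ((dist_pi_lt_iff hε).2 fun i => by simpa using hx i (Set.mem_univ i))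

/-- If a monic polynomial `M` over an integrally closed domain is prime and does not divide `G`,
then the ideal `(M, G)` contains a nonzero constant. -/
theorem exists_mul_add_mul_eq_C {R : Type*} [CommRing R] [IsDomain R] [IsIntegrallyClosed R]
    {M G : Polynomial R} (hM : M.Monic) (hp : Irreducible M) (hG : ¬ M ∣ G) :
    ∃ (r : R) (A B : Polynomial R), r ≠ 0 ∧ A * M + B * G = Polynomial.C r := by
  let K := FractionRing R
  have hinj : Function.Injective (algebraMap R K) := IsFractionRing.injective R K
  -- By Gauss's lemma `M` stays irreducible over the fraction field; a Bézout identity there yields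
  -- the claim after clearing denominators.
  have hK := (hM.irreducible_iff_irreducible_map_fraction_map (K := K)).1 hp
  obtain ⟨A, B, hAB⟩ := (EuclideanDomain.dvd_or_coprime _ (G.map (algebraMap R K)) hK).resolve_left
    fun h => hG ((Polynomial.map_dvd_map _ hinj hM).1 h)
  obtain ⟨b, hb, hb'⟩ := IsLocalization.integerNormalization_spec (nonZeroDivisors R) A
  obtain ⟨c, hc, hc'⟩ := IsLocalization.integerNormalization_spec (nonZeroDivisors R) B
  refine ⟨b * c, Polynomial.C c * IsLocalization.integerNormalization (nonZeroDivisors R) A,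
    Polynomial.C b * IsLocalization.integerNormalization (nonZeroDivisors R) B,
    mul_ne_zero (nonZeroDivisors.ne_zero hb) (nonZeroDivisors.ne_zero hc), ?_⟩
  apply Polynomial.map_injective _ hinj
  simp only [Polynomial.map_add, Polynomial.map_mul, Polynomial.map_C, hb', hc', map_mul]
  rw [← algebraMap_smul K b A, ← algebraMap_smul K c B, Polynomial.smul_eq_C_mul,
    Polynomial.smul_eq_C_mul]
  linear_combination Polynomial.C (algebraMap R K b) * Polynomial.C (algebraMap R K c) * hAB

/-- An irreducible polynomial that vanishes at `a` divides every polynomial that vanishes on its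
zero set near `a`. -/
theorem dvd_of_eventually_eval_eq_zero {q P : MvPolynomial (Fin n) ℂ} (hq : Irreducible q)
    {a : Fin n → ℂ} (ha : eval a q = 0) (h : ∀ᶠ z in 𝓝 a, eval z q = 0 → eval z P = 0) :
    q ∣ P := by
  obtain ⟨v, hv⟩ : ∃ v, eval v (homogeneousComponent q.totalDegree q) ≠ 0 := by
    by_contra! h0
    exact homogeneousComponent_totalDegree_ne_zero hq.ne_zero (MvPolynomial.funext (by simpa))
  set u := eval v (homogeneousComponent q.totalDegree q) with hu
  set M : Polynomial (MvPolynomial (Fin n) ℂ) := Polynomial.C (C u⁻¹) * lineHom v q with hMdef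
  have huu : Polynomial.C (C u) * Polynomial.C (C u⁻¹) =
      (1 : Polynomial (MvPolynomial (Fin n) ℂ)) := by
    rw [← Polynomial.C_mul, ← C_mul, mul_inv_cancel₀ hv, C_1, Polynomial.C_1]
  have hdeg : (lineHom v q).natDegree = q.totalDegree := by
    refine (natDegree_lineHom_le v q).antisymm (Polynomial.le_natDegree_of_ne_zero ?_)
    rw [coeff_lineHom_totalDegree]
    simpa using hv
  have hM : M.Monic := by
    rw [hMdef]
    apply Polynomial.monic_C_mul_of_mul_leadingCoeff_eq_one
    rw [Polynomial.leadingCoeff, hdeg, coeff_lineHom_totalDegree, ← C_mul, ← hu,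
      inv_mul_cancel₀ hv, C_1]
  have hassoc : Associated (lineHom v q) M :=
    ⟨⟨Polynomial.C (C u⁻¹), Polynomial.C (C u), by rw [mul_comm, huu], huu⟩, mul_comm _ _⟩
  have hMirr : Irreducible M :=
    hassoc.irreducible (prime_lineHom v hq.prime).irreducible
  by_contra hqP
  obtain ⟨r, A, B, hr, hAB⟩ := exists_mul_add_mul_eq_C hM hMirr (G := lineHom v P) fun hd =>
    hqP (dvd_of_lineHom_dvd (hassoc.dvd.trans hd))
  have hevalM : ∀ z t, (M.map (eval z)).eval t = u⁻¹ * eval (z + t • v) q := by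
    intro z t
    rw [hMdef, Polynomial.map_mul, Polynomial.eval_mul, eval_eval_lineHom]
    simp
  have hcont : Tendsto (fun x : (Fin n → ℂ) × ℂ => x.1 + x.2 • v) (𝓝 a ×ˢ 𝓝 0) (𝓝 a) := by
    rw [← nhds_prod_eq]
    have : Continuous fun x : (Fin n → ℂ) × ℂ => x.1 + x.2 • v := by fun_prop
    simpa using this.tendsto (a, 0)
  obtain ⟨pa, hpa, pb, hpb, hab⟩ := Filter.eventually_prod_iff.1 (hcont.eventually h)
  obtain ⟨ε, hε, hball⟩ := Metric.eventually_nhds_iff.1 hpb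
  have hsmall : ∀ᶠ z in 𝓝 a, ‖(M.map (eval z)).eval 0‖ < ε ^ M.natDegree := by
    have hc : Continuous fun z => ‖(M.map (eval z)).eval 0‖ := by
      simp only [hevalM, zero_smul, add_zero]
      exact (continuous_const.mul q.continuous_eval).norm
    refine hc.tendsto a |>.eventually_lt_const ?_
    rw [hevalM, zero_smul, add_zero, ha, mul_zero, norm_zero]
    positivity
  -- For `z` near `a` the monic `M(z, ·)` has a small root `t`. Both `q` and `P` vanish at `z + t
  -- v`, so the Bézout identity evaluated at `(z, t)` reads `r(z) = 0`.
  refine hr (eq_zero_of_eventually_eval_eq_zero (a := a) ?_)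
  filter_upwards [hsmall, hpa] with z hz hza
  have hmon : (M.map (eval z)).Monic := hM.map _
  have hnd : (M.map (eval z)).natDegree = M.natDegree := hM.natDegree_map _
  obtain ⟨t, ht, htε⟩ := exists_isRoot_norm_lt hmon hε (by rwa [hnd])
  have hq0 : eval (z + t • v) q = 0 := by
    have h1 := hevalM z t
    rw [ht.eq_zero] at h1
    exact (mul_eq_zero.1 h1.symm).resolve_left (inv_ne_zero hv)
  have hP0 := hab hza (hball (by simpa using htε)) hq0
  have h2 := congrArg (fun F => (F.map (eval z)).eval t) hAB
  simp only [Polynomial.map_add, Polynomial.map_mul, Polynomial.eval_add, Polynomial.eval_mul,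
    eval_eval_lineHom, hP0, ht.eq_zero, Polynomial.map_C, Polynomial.eval_C] at h2
  simpa using h2.symm

theorem exists_irreducible_dvd_eval_eq_zero {Q : MvPolynomial (Fin n) ℂ} (hQ : Q ≠ 0)
    {a : Fin n → ℂ} (ha : eval a Q = 0) : ∃ q, Irreducible q ∧ q ∣ Q ∧ eval a q = 0 := by
  induction Q using WfDvdMonoid.induction_on_irreducible with
  | zero => exact absurd rfl hQ
  | unit u hu => exact absurd ha (hu.map (eval a)).ne_zero
  | mul b i hb hi ih =>
    rw [eval_mul, mul_eq_zero] at ha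
    rcases ha with ha | ha
    · exact ⟨i, hi, dvd_mul_right i b, ha⟩
    · obtain ⟨q, hq, hd, h0⟩ := ih hb ha
      exact ⟨q, hq, hd.mul_left i, h0⟩

theorem eval_ne_zero_of_isRelPrime {P Q : MvPolynomial (Fin n) ℂ} (hPQ : IsRelPrime P Q)
    (hQ : Q ≠ 0) {a : Fin n → ℂ} (h : ∀ᶠ z in 𝓝 a, eval z Q = 0 → eval z P = 0) :
    eval a Q ≠ 0 := by
  intro ha
  obtain ⟨q, hq, hqQ, hqa⟩ := exists_irreducible_dvd_eval_eq_zero hQ ha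
  refine hq.not_isUnit (hPQ (dvd_of_eventually_eval_eq_zero hq hqa ?_) hqQ)
  filter_upwards [h] with z hz hzq
  exact hz (zero_dvd_iff.1 (hzq ▸ map_dvd (eval z) hqQ))

/-! ### The polydisc, its torus and the maximum principle -/

theorem polydisc_eq_pi_ball : polydisc n = Set.univ.pi fun _ => Metric.ball (0 : ℂ) 1 := by
  ext z
  simp [polydisc]

theorem isOpen_polydisc : IsOpen (polydisc n) := by
  rw [polydisc_eq_pi_ball]
  exact isOpen_set_pi Set.finite_univ fun _ _ => Metric.isOpen_ball

theorem isPreconnected_polydisc : IsPreconnected (polydisc n) := by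
  rw [polydisc_eq_pi_ball]
  exact (convex_pi fun _ _ => convex_ball _ _).isPreconnected

theorem zero_mem_polydisc : (0 : Fin n → ℂ) ∈ polydisc n := fun _ => by simp

theorem torusMap_mem_torus (θ : Fin n → ℝ) : torusMap 0 1 θ ∈ torus n := fun j => by
  simp [torusMap, Complex.norm_exp_ofReal_mul_I]

theorem exists_torusMap_eq {w : Fin n → ℂ} (hw : w ∈ torus n) :
    ∃ θ : Fin n → ℝ, torusMap 0 1 θ = w := by
  refine ⟨fun j => Complex.arg (w j), ?_⟩
  ext j
  have := Complex.norm_mul_exp_arg_mul_I (w j)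
  rw [hw j, Complex.ofReal_one, one_mul] at this
  simpa [torusMap] using this

theorem continuous_torusMap : Continuous fun θ : Fin n → ℝ => torusMap 0 1 θ := by
  unfold torusMap
  fun_prop

theorem smul_mem_polydisc {w : Fin n → ℂ} (hw : ∀ j, ‖w j‖ ≤ 1) {r : ℝ} (h0 : 0 ≤ r)
    (h1 : r < 1) : r • w ∈ polydisc n := fun j => by
  rw [Pi.smul_apply, norm_smul, Real.norm_of_nonneg h0]
  exact (mul_le_of_le_one_right h0 (hw j)).trans_lt h1

theorem eventually_smul_mem_polydisc {w : Fin n → ℂ} (hw : ∀ j, ‖w j‖ ≤ 1) :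
    ∀ᶠ r : ℝ in 𝓝[<] 1, r • w ∈ polydisc n := by
  filter_upwards [Ioo_mem_nhdsLT (zero_lt_one' ℝ)] with r hr
  exact smul_mem_polydisc hw hr.1.le hr.2

theorem tendsto_eval_smul (F : MvPolynomial (Fin n) ℂ) (w : Fin n → ℂ) :
    Tendsto (fun r : ℝ => eval (r • w) F) (𝓝[<] 1) (𝓝 (eval w F)) := by
  have hc : Continuous fun r : ℝ => eval (r • w) F :=
    F.continuous_eval.comp (by fun_prop)
  simpa using (hc.tendsto 1).mono_left nhdsWithin_le_nhds

theorem differentiable_eval (F : MvPolynomial (Fin n) ℂ) :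
    Differentiable ℂ fun z : Fin n → ℂ => eval z F := fun z =>
  (AnalyticOnNhd.eval_mvPolynomial F z (Set.mem_univ z)).differentiableAt

/-- The maximum principle: the torus is a boundary of the closed polydisc. -/
theorem norm_le_of_forall_torus_norm_le {F : (Fin n → ℂ) → ℂ} {C : ℝ}
    (hF : ∀ z, (∀ j, ‖z j‖ ≤ 1) → DifferentiableAt ℂ F z) (hC : ∀ w ∈ torus n, ‖F w‖ ≤ C)
    {z : Fin n → ℂ} (hz : ∀ j, ‖z j‖ ≤ 1) : ‖F z‖ ≤ C := by
  -- Coordinates are pushed to the unit circle one at a time by the one-variable maximum principle;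
  -- `s` holds those not yet known to have modulus `1`.
  have key : ∀ (s : Finset (Fin n)) (z : Fin n → ℂ), (∀ j, ‖z j‖ ≤ 1) →
      (∀ j ∉ s, ‖z j‖ = 1) → ‖F z‖ ≤ C := by
    intro s
    induction s using Finset.induction_on with
    | empty => exact fun z _ h => hC z fun j => h j (Finset.notMem_empty j)
    | insert i s hi ih =>
      intro z hz hzs
      have hup : ∀ t : ℂ, ‖t‖ ≤ 1 → ∀ j, ‖Function.update z i t j‖ ≤ 1 := by
        intro t ht j
        by_cases hj : j = i
        · subst hj; simpa
        · simpa [hj] using hz j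
      have hd : DiffContOnCl ℂ (fun t => F (Function.update z i t)) (Metric.ball 0 1) := by
        refine DifferentiableOn.diffContOnCl fun t ht => ?_
        rw [closure_ball _ one_ne_zero, mem_closedBall_zero_iff] at ht
        exact ((hF _ (hup t ht)).comp t
          (hasFDerivAt_update z t).differentiableAt).differentiableWithinAt
      have := Complex.norm_le_of_forall_mem_frontier_norm_le Metric.isBounded_ball hd
        (C := C) (fun t ht => ?_) (z := z i) ?_
      · simpa using this
      · rw [frontier_ball _ one_ne_zero, mem_sphere_zero_iff_norm] at ht
        refine ih _ (hup t ht.le) fun j hj => ?_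
        by_cases hji : j = i
        · subst hji; simpa
        · simpa [hji] using hzs j (by simp [hji, hj])
      · rw [closure_ball _ one_ne_zero, mem_closedBall_zero_iff]
        exact hz i
  exact key Finset.univ z hz fun j hj => absurd (Finset.mem_univ j) hj

/-- `Q` may vanish on the torus, so the maximum principle is applied to `r^N Q*(z/r) / Q(r z)` with
`r < 1`. This is holomorphic near the closed polydisc and unimodular on the torus; then `r → 1`. -/
theorem norm_eval_reflection_le {Q : MvPolynomial (Fin n) ℂ}
    (hQ : ∀ z ∈ polydisc n, eval z Q ≠ 0) {z : Fin n → ℂ} (hz : ∀ j, ‖z j‖ ≤ 1) :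
    ‖eval z (reflection Q)‖ ≤ ‖eval z Q‖ := by
  set N := ∑ j, nu Q j
  have key : ∀ r ∈ Set.Ioo (0 : ℝ) 1,
      ‖(r : ℂ) ^ N * eval (r⁻¹ • z) (reflection Q)‖ ≤ ‖eval (r • z) Q‖ := by
    intro r hr
    have hr0 : (r : ℂ) ≠ 0 := Complex.ofReal_ne_zero.2 hr.1.ne'
    have hne : ∀ z : Fin n → ℂ, (∀ j, ‖z j‖ ≤ 1) → eval (r • z) Q ≠ 0 := fun z hz =>
      hQ _ (smul_mem_polydisc hz hr.1.le hr.2)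
    have h := norm_le_of_forall_torus_norm_le
      (F := fun z => (r : ℂ) ^ N * eval (r⁻¹ • z) (reflection Q) / eval (r • z) Q) (C := 1)
      (fun z hz => ?_) (fun w hw => ?_) hz
    · rwa [norm_div, div_le_one (norm_pos_iff.2 (hne z hz))] at h
    · have h1 : DifferentiableAt ℂ (fun z : Fin n → ℂ => eval (r⁻¹ • z) (reflection Q)) z :=
        (differentiable_eval (reflection Q)).comp (by fun_prop :
          Differentiable ℂ fun z : Fin n → ℂ => r⁻¹ • z) z
      have h2 : DifferentiableAt ℂ (fun z : Fin n → ℂ => eval (r • z) Q) z :=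
        (differentiable_eval Q).comp (by fun_prop : Differentiable ℂ fun z : Fin n → ℂ => r • z) z
      simp only [div_eq_mul_inv]
      exact (h1.const_mul _).mul (h2.fun_inv (hne z hz))
    · rw [norm_div, div_le_one (norm_pos_iff.2 (hne w fun j => (hw j).le))]
      have hw0 := ne_zero_of_mem_torus hw
      rw [eval_reflection_eq_conj Q (r⁻¹ • w) fun j => by simp [hw0 j, hr.1.ne']]
      -- Inversion in the unit circle sends `w_j / r` to `r w_j`, which is why numerator and
      -- denominator are scaled oppositely.
      have hpt : (fun j => (conj ((r⁻¹ • w) j))⁻¹) = r • w := by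
        funext j
        rw [Pi.smul_apply, Pi.smul_apply, Complex.real_smul, Complex.real_smul, map_mul,
          Complex.conj_ofReal, mul_inv, Complex.ofReal_inv, inv_inv, Complex.inv_def,
          Complex.conj_conj, Complex.normSq_conj, Complex.normSq_eq_norm_sq, hw j]
        simp
      rw [hpt]
      have hprod : ‖∏ j, (r⁻¹ • w) j ^ nu Q j‖ = (r ^ N)⁻¹ := by
        simp only [norm_prod, norm_pow, Pi.smul_apply, norm_smul, hw _, mul_one, norm_inv,
          Real.norm_of_nonneg hr.1.le]
        rw [Finset.prod_pow_eq_pow_sum, inv_pow]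
      rw [norm_mul, norm_mul, hprod, norm_pow, Complex.norm_real, Real.norm_of_nonneg hr.1.le,
        RCLike.norm_conj, mul_inv_cancel_left₀ (pow_pos hr.1 N).ne']
  have hleft : Tendsto (fun r : ℝ => ‖(r : ℂ) ^ N * eval (r⁻¹ • z) (reflection Q)‖) (𝓝[<] 1)
      (𝓝 ‖eval z (reflection Q)‖) := by
    have hc : ContinuousAt (fun r : ℝ => ‖(r : ℂ) ^ N * eval (r⁻¹ • z) (reflection Q)‖) 1 := by
      refine (ContinuousAt.mul (by fun_prop) ?_).norm
      refine (reflection Q).continuous_eval.continuousAt.comp ?_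
      exact (continuousAt_inv₀ one_ne_zero).smul continuousAt_const
    simpa [ContinuousAt] using hc.tendsto.mono_left nhdsWithin_le_nhds
  refine le_of_tendsto_of_tendsto hleft (tendsto_eval_smul Q z).norm ?_
  filter_upwards [Ioo_mem_nhdsLT (zero_lt_one' ℝ)] with r hr using key r hr

theorem norm_eval_monomial_mul_reflection_le {Q : MvPolynomial (Fin n) ℂ}
    (hQ : ∀ z ∈ polydisc n, eval z Q ≠ 0) {c : ℂ} (hc : ‖c‖ = 1) (β : Fin n →₀ ℕ)
    {z : Fin n → ℂ} (hz : ∀ j, ‖z j‖ ≤ 1) :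
    ‖eval z (C c * monomial β 1 * reflection Q)‖ ≤ ‖eval z Q‖ := by
  rw [eval_mul, eval_mul, eval_C, norm_mul, norm_mul, hc, one_mul, eval_monomial_one]
  refine (mul_le_of_le_one_left (norm_nonneg _) ?_).trans (norm_eval_reflection_le hQ hz)
  rw [norm_prod]
  exact Finset.prod_le_one (fun _ _ => norm_nonneg _) fun j _ => by
    rw [norm_pow]; exact pow_le_one₀ (norm_nonneg _) (hz j)

/-- By Fubini it suffices to look along lines in the direction `(1, …, 1)`. There `Q` is a
one-variable polynomial in `e^{it}`, nonzero because its constant term is `Q(0)`, so it vanishes for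
only countably many `t`. -/
theorem ae_eval_torusMap_ne_zero {Q : MvPolynomial (Fin n) ℂ} (hQ : eval 0 Q ≠ 0) :
    ∀ᵐ θ : Fin n → ℝ, eval (torusMap 0 1 θ) Q ≠ 0 := by
  refine ae_mem_of_ae_add_linearMap_mem
    (LinearMap.toSpanSingleton ℝ (Fin n → ℝ) (fun _ => 1)) volume volume
    (s := {θ | eval (torusMap 0 1 θ) Q ≠ 0}) ?_ fun θ => ?_
  · exact (isOpen_ne_fun (Q.continuous_eval.comp continuous_torusMap)
      continuous_const).measurableSet
  · set p : Polynomial ℂ := (lineHom (torusMap 0 1 θ) Q).map (eval 0) with hp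
    have hpt : ∀ t, p.eval t = eval (t • torusMap 0 1 θ) Q := fun t => by
      rw [hp, eval_eval_lineHom, zero_add]
    have hp0 : p ≠ 0 := by
      intro h0
      have := hpt 0
      rw [h0, Polynomial.eval_zero, zero_smul] at this
      exact hQ this.symm
    have hsub : {t : ℝ | ¬ eval (torusMap 0 1
        (θ + LinearMap.toSpanSingleton ℝ (Fin n → ℝ) (fun _ => 1) t)) Q ≠ 0} ⊆
        ⋃ x ∈ p.roots.toFinset, {t : ℝ | Complex.exp (t * Complex.I) = x} := by
      intro t ht
      simp only [Set.mem_ofPred_eq, not_not] at ht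
      simp only [Set.mem_iUnion, Set.mem_ofPred_eq, exists_prop, exists_eq_right',
        Multiset.mem_toFinset]
      rw [Polynomial.mem_roots hp0, Polynomial.IsRoot, hpt, ← ht]
      congr 2
      ext j
      simp only [torusMap, LinearMap.toSpanSingleton_apply, Pi.smul_apply, Pi.add_apply, Pi.zero_apply,
        Pi.one_apply, smul_eq_mul, mul_one, Complex.ofReal_add, Complex.ofReal_one, zero_add, one_mul,
        add_mul, Complex.exp_add]
      ring
    refine measure_mono_null hsub (Set.Countable.measure_zero ?_ _)
    refine (Finset.countable_toSet _).biUnion fun x _ => ?_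
    rcases Set.eq_empty_or_nonempty {t : ℝ | Complex.exp (t * Complex.I) = x} with h | ⟨t₀, ht₀⟩
    · rw [h]; exact Set.countable_empty
    · refine (Set.countable_range fun k : ℤ => t₀ + k * (2 * Real.pi)).mono fun t ht => ?_
      obtain ⟨k, hk⟩ := Complex.exp_eq_exp_iff_exists_int.1 (ht.trans ht₀.symm)
      refine ⟨k, ?_⟩
      have h2 : (t : ℂ) = t₀ + k * (2 * Real.pi) := by
        apply mul_right_cancel₀ Complex.I_ne_zero
        rw [hk]; ring
      exact_mod_cast h2.symm

/-! ### Rational inner functions as reduced quotients -/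

/-- The rational inner functions given by Rudin's formula. -/
theorem isRationalInner_of_reflection {Q : MvPolynomial (Fin n) ℂ}
    (hQ : ∀ z ∈ polydisc n, eval z Q ≠ 0) {c : ℂ} (hc : ‖c‖ = 1) (β : Fin n →₀ ℕ) :
    IsRationalInner fun z =>
      eval z (C c * monomial β 1 * reflection Q) / eval z Q := by
  have hQ0 := hQ 0 zero_mem_polydisc
  refine ⟨⟨?_, ⟨1, fun z hz => ?_⟩, ?_⟩, _, Q, ?_, fun z hz => mul_div_cancel₀ _ (hQ z hz)⟩
  · intro z hz
    simp only [div_eq_mul_inv]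
    exact ((differentiable_eval (C c * monomial β 1 * reflection Q) z).mul
      ((differentiable_eval Q z).fun_inv (hQ z hz))).differentiableWithinAt
  · rw [norm_div, div_le_one (norm_pos_iff.2 (hQ z hz))]
    exact norm_eval_monomial_mul_reflection_le hQ hc β fun j => (hz j).le
  · filter_upwards [ae_eval_torusMap_ne_zero hQ0] with θ hθ
    have h := ((tendsto_eval_smul (C c * monomial β 1 * reflection Q) (torusMap 0 1 θ)).div
      (tendsto_eval_smul Q _) hθ).norm
    have hw := torusMap_mem_torus θ
    rwa [norm_div, eval_mul, eval_mul, eval_C, eval_monomial_one, norm_mul, norm_mul, hc,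
      norm_prod_pow_of_mem_torus hw, norm_eval_reflection_of_mem_torus Q hw, one_mul, one_mul,
      div_self (norm_ne_zero_iff.2 hθ)] at h
  · rintro rfl
    simp at hQ0

theorem IsRationalInner.exists_isRelPrime {f : (Fin n → ℂ) → ℂ} (hf : IsRationalInner f) :
    ∃ P Q : MvPolynomial (Fin n) ℂ, IsRelPrime P Q ∧ (∀ z ∈ polydisc n, eval z Q ≠ 0) ∧
      (∀ w ∈ torus n, ‖eval w P‖ = ‖eval w Q‖) ∧ ∀ z ∈ polydisc n, f z = eval z P / eval z Q := by
  obtain ⟨⟨hol, -, hlim⟩, P₀, Q₀, hQ₀, hPQ₀⟩ := hf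
  obtain ⟨Q, P, D, hrel, rfl, rfl⟩ := UniqueFactorizationMonoid.exists_reduced_factors Q₀ hQ₀ P₀
  have hD : D ≠ 0 := left_ne_zero_of_mul hQ₀
  have hQ : Q ≠ 0 := right_ne_zero_of_mul hQ₀
  -- The common factor `D` can be cancelled even at its zeros: if the identity failed at `a`, it
  -- would fail near `a` by continuity, forcing `D = 0`.
  have hmul : ∀ z ∈ polydisc n, eval z Q * f z = eval z P := by
    intro a ha
    by_contra hne
    have hopen := isOpen_polydisc.mem_nhds ha
    have hcont : ContinuousAt (fun z => eval z Q * f z) a :=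
      Q.continuous_eval.continuousAt.mul (hol.continuousOn.continuousAt hopen)
    refine hD (eq_zero_of_eventually_eval_eq_zero (a := a) ?_)
    filter_upwards [hopen,
      (hcont.sub P.continuous_eval.continuousAt).eventually_ne (sub_ne_zero.2 hne)] with z hz hz'
    have h := hPQ₀ z hz
    rw [eval_mul, eval_mul, mul_assoc] at h
    by_contra h0
    exact hz' (sub_eq_zero.2 (mul_left_cancel₀ h0 h))
  have hQD : ∀ z ∈ polydisc n, eval z Q ≠ 0 := by
    intro a ha
    refine eval_ne_zero_of_isRelPrime hrel.symm hQ ?_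
    filter_upwards [isOpen_polydisc.mem_nhds ha] with z hz h0
    rw [← hmul z hz, h0, zero_mul]
  refine ⟨P, Q, hrel.symm, hQD, ?_, fun z hz => ?_⟩
  · have hae : (fun θ : Fin n → ℝ => ‖eval (torusMap 0 1 θ) P‖) =ᵐ[volume]
        fun θ => ‖eval (torusMap 0 1 θ) Q‖ := by
      filter_upwards [hlim] with θ hθ
      have h1 := (tendsto_eval_smul Q (torusMap 0 1 θ)).norm.mul hθ
      rw [mul_one] at h1
      refine tendsto_nhds_unique (tendsto_eval_smul P (torusMap 0 1 θ)).norm (h1.congr' ?_)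
      filter_upwards [eventually_smul_mem_polydisc fun j => (torusMap_mem_torus θ j).le] with r hr
      rw [← hmul _ hr, norm_mul]
    -- Continuous functions that agree almost everywhere agree everywhere.
    have heq := (Continuous.ae_eq_iff_eq volume
      (P.continuous_eval.comp continuous_torusMap).norm
      (Q.continuous_eval.comp continuous_torusMap).norm).1 hae
    intro w hw
    obtain ⟨θ, rfl⟩ := exists_torusMap_eq hw
    exact congrFun heq θ
  · rw [eq_div_iff (hQD z hz), mul_comm, hmul z hz]

theorem eq_monomial_mul_reflection_of_polydisc {P Q : MvPolynomial (Fin n) ℂ}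
    (hPQ : IsRelPrime P Q) (hQ : ∀ z ∈ polydisc n, eval z Q ≠ 0)
    (hT : ∀ w ∈ torus n, ‖eval w P‖ = ‖eval w Q‖) :
    ∃ (c : ℂ) (β : Fin n →₀ ℕ), ‖c‖ = 1 ∧ P = C c * monomial β 1 * reflection Q := by
  have hQ0 := hQ 0 zero_mem_polydisc
  refine eq_monomial_mul_reflection hPQ (fun j => ?_) ?_ hT
  · refine ((X_prime (i := j)).irreducible.isRelPrime_iff_not_dvd.2 ?_).symm
    rintro ⟨S, rfl⟩
    simp at hQ0
  · rintro rfl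
    simp at hQ0

theorem norm_eval_le_of_isRelPrime {P Q : MvPolynomial (Fin n) ℂ}
    (hPQ : IsRelPrime P Q) (hQ : ∀ z ∈ polydisc n, eval z Q ≠ 0)
    (hT : ∀ w ∈ torus n, ‖eval w P‖ = ‖eval w Q‖) {z : Fin n → ℂ} (hz : z ∈ polydisc n) :
    ‖eval z P‖ ≤ ‖eval z Q‖ := by
  obtain ⟨c, β, hc, rfl⟩ := eq_monomial_mul_reflection_of_polydisc hPQ hQ hT
  exact norm_eval_monomial_mul_reflection_le hQ hc β fun j => (hz j).le

/-- For a unit, `P` is zero-free as well, so `|P| ≤ |Q|` holds with the roles exchanged too. Thus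
`|f| = 1` throughout, and the maximum modulus principle makes `f` constant. -/
theorem IsRationalInner.eq_const_of_isHolomorphicUnit {f : (Fin n → ℂ) → ℂ}
    (hf : IsRationalInner f) (hu : IsHolomorphicUnit f) :
    ∃ c : ℂ, ‖c‖ = 1 ∧ ∀ z ∈ polydisc n, f z = c := by
  obtain ⟨P, Q, hPQ, hQ, hT, hfPQ⟩ := hf.exists_isRelPrime
  obtain ⟨-, g, -, hfg⟩ := hu
  have hP : ∀ z ∈ polydisc n, eval z P ≠ 0 := by
    intro z hz h0
    have := hfg z hz
    rw [hfPQ z hz, h0] at this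
    simp at this
  have hnorm : ∀ z ∈ polydisc n, ‖f z‖ = 1 := by
    intro z hz
    rw [hfPQ z hz, norm_div, (norm_eval_le_of_isRelPrime hPQ hQ hT hz).antisymm
      (norm_eval_le_of_isRelPrime hPQ.symm hP (fun w hw => (hT w hw).symm) hz),
      div_self (norm_ne_zero_iff.2 (hQ z hz))]
  refine ⟨f 0, hnorm 0 zero_mem_polydisc, fun z hz => ?_⟩
  refine Complex.eqOn_of_isPreconnected_of_isMaxOn_norm isPreconnected_polydisc isOpen_polydisc
    hf.1.1 zero_mem_polydisc (fun z hz => ?_) hz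
  simp [hnorm z hz, hnorm 0 zero_mem_polydisc]

/-! ### Splitting off a factor that vanishes at the origin -/

theorem not_isHolomorphicUnit_of_eq_zero {f : (Fin n → ℂ) → ℂ} {a : Fin n → ℂ}
    (ha : a ∈ polydisc n) (hfa : f a = 0) : ¬ IsHolomorphicUnit f := by
  rintro ⟨-, g, -, h⟩
  simpa [hfa] using h a ha

/-- If an irreducible inner function is a product of rational inner functions, the first of which
vanishes somewhere, then the second one is constant. -/
theorem IsIrreducibleInner.exists_eq_const_mul {f g h : (Fin n → ℂ) → ℂ}
    (hf : IsIrreducibleInner f) (hg : IsRationalInner g) (hh : IsRationalInner h)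
    (hg0 : ∃ a ∈ polydisc n, g a = 0) (hfgh : ∀ z ∈ polydisc n, f z = g z * h z) :
    ∃ c : ℂ, ‖c‖ = 1 ∧ ∀ z ∈ polydisc n, f z = c * g z := by
  obtain ⟨a, ha, hga⟩ := hg0
  have hu : IsHolomorphicUnit h := by
    by_contra hu
    exact hf.2.2 ⟨g, h, hg, hh, not_isHolomorphicUnit_of_eq_zero ha hga, hu, hfgh⟩
  obtain ⟨c, hc, hhc⟩ := hh.eq_const_of_isHolomorphicUnit hu
  exact ⟨c, hc, fun z hz => by rw [hfgh z hz, hhc z hz, mul_comm]⟩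

theorem exists_irreducible_dvd_reflection_eq_zero {Q : MvPolynomial (Fin n) ℂ} (hQ : Q ≠ 0)
    (h : eval 0 (reflection Q) = 0) :
    ∃ q, Irreducible q ∧ q ∣ Q ∧ eval 0 (reflection q) = 0 := by
  induction Q using WfDvdMonoid.induction_on_irreducible with
  | zero => exact absurd rfl hQ
  | unit u hu =>
    -- The reflections of `u` and its inverse multiply to the reflection of `1`, which has value `1`
    -- at the origin.
    obtain ⟨v, hv⟩ := hu.exists_right_inv
    have h1 := reflection_mul hQ (right_ne_zero_of_mul_eq_one hv)
    have h2 := congrArg (eval 0) h1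
    rw [hv, eval_mul, h, zero_mul, eval_zero_reflection] at h2
    have h3 : nu (1 : MvPolynomial (Fin n) ℂ) = 0 := nu_monomial 0 one_ne_zero
    simp [h3] at h2
  | mul b i hb hi ih =>
    rw [reflection_mul hi.ne_zero hb, eval_mul, mul_eq_zero] at h
    rcases h with h | h
    · exact ⟨i, hi, dvd_mul_right i b, h⟩
    · obtain ⟨q, hq, hd, h0⟩ := ih hb h
      exact ⟨q, hq, hd.mul_left i, h0⟩

end PolydiscInner

open PolydiscInner in
theorem corollary2p3 (n : ℕ) (f : (Fin n → ℂ) → ℂ)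
    (hf : PolydiscInner.IsIrreducibleInner f) (hf0 : f 0 = 0) :
    ∃ c : ℂ, ‖c‖ = 1 ∧
      ((∃ j : Fin n, ∀ z ∈ PolydiscInner.polydisc n, f z = c * z j) ∨
        ∃ Q : MvPolynomial (Fin n) ℂ,
          Irreducible Q ∧
          (∀ z ∈ PolydiscInner.polydisc n, MvPolynomial.eval z Q ≠ 0) ∧
          PolydiscInner.DeficientInDegree Q ∧
          ∀ z ∈ PolydiscInner.polydisc n,
            f z = c * (MvPolynomial.eval z (PolydiscInner.reflection Q) /
              MvPolynomial.eval z Q)) := by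
  obtain ⟨P, Q, hPQ, hQ, hT, hfPQ⟩ := hf.1.exists_isRelPrime
  obtain ⟨c, β, hc, rfl⟩ := eq_monomial_mul_reflection_of_polydisc hPQ hQ hT
  have hQ0 := hQ 0 zero_mem_polydisc
  by_cases hβ : β = 0
  · have hQne : Q ≠ 0 := by rintro rfl; simp at hQ0
    have hr0 : eval 0 (reflection Q) = 0 := by
      have h := hfPQ 0 zero_mem_polydisc
      rw [hf0, eq_comm, div_eq_zero_iff, hβ] at h
      have h := h.resolve_right hQ0
      have hc0 : c ≠ 0 := norm_ne_zero_iff.1 (by rw [hc]; exact one_ne_zero)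
      simpa [eval_mul, eval_monomial_one, hc0] using h
    obtain ⟨q, hq, ⟨S, rfl⟩, hq0⟩ := exists_irreducible_dvd_reflection_eq_zero hQne hr0
    have hqD : ∀ z ∈ polydisc n, eval z q ≠ 0 := fun z hz =>
      left_ne_zero_of_mul (eval_mul (R := ℂ) ▸ hQ z hz)
    have hSD : ∀ z ∈ polydisc n, eval z S ≠ 0 := fun z hz =>
      right_ne_zero_of_mul (eval_mul (R := ℂ) ▸ hQ z hz)
    -- With `Q = q S`, the factorization is `f = (q* / q) · (c S* / S)`.
    obtain ⟨d, hd, hfd⟩ := hf.exists_eq_const_mul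
      (isRationalInner_of_reflection hqD norm_one 0) (isRationalInner_of_reflection hSD hc 0)
      ⟨0, zero_mem_polydisc, by simp only [eval_mul, hq0, mul_zero, zero_div]⟩ fun z hz => by
        rw [hfPQ z hz, reflection_mul hq.ne_zero (right_ne_zero_of_mul hQne)]
        simp only [eval_mul, eval_C, eval_monomial_one, hβ, Finsupp.coe_zero, Pi.zero_apply,
          pow_zero, Finset.prod_const_one]
        field_simp [hqD z hz, hSD z hz]
    refine ⟨d, hd, Or.inr ⟨q, hq, hqD, (deficientInDegree_iff q).2 hq0, fun z hz => ?_⟩⟩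
    rw [hfd z hz]
    simp
  · obtain ⟨j, hj⟩ := Finsupp.ne_iff.1 hβ
    have hle : Finsupp.single j 1 ≤ β := by
      rw [Finsupp.single_le_iff]
      exact Nat.one_le_iff_ne_zero.2 hj
    have hone : ∀ z ∈ polydisc n, eval z (1 : MvPolynomial (Fin n) ℂ) ≠ 0 := by simp
    have hrone : reflection (1 : MvPolynomial (Fin n) ℂ) = 1 := by
      have h3 : nu (1 : MvPolynomial (Fin n) ℂ) = 0 := nu_monomial 0 one_ne_zero
      refine eq_of_eqOn_torus fun w hw => ?_
      simp [eval_reflection_of_mem_torus _ hw, h3]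
    have hX : ∀ z : Fin n → ℂ, eval z (monomial (Finsupp.single j 1) (1 : ℂ)) = z j := fun z =>
      eval_X j
    -- The factor `z_j` is Rudin's formula with denominator `1` and exponent `e_j`; the cofactor
    -- keeps `Q` and has exponent `β - e_j`.
    obtain ⟨d, hd, hfd⟩ := hf.exists_eq_const_mul
      (isRationalInner_of_reflection hone norm_one (Finsupp.single j 1))
      (isRationalInner_of_reflection hQ hc (β - Finsupp.single j 1))
      ⟨0, zero_mem_polydisc, by
        simp only [eval_mul, hX, Pi.zero_apply, mul_zero, zero_mul, zero_div]⟩ fun z hz => by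
        have h3 : monomial β (1 : ℂ) =
            monomial (Finsupp.single j 1) 1 * monomial (β - Finsupp.single j 1) 1 := by
          rw [monomial_mul, one_mul, add_tsub_cancel_of_le hle]
        rw [hfPQ z hz, hrone, h3]
        simp only [eval_mul, eval_C, map_one]
        field_simp
    refine ⟨d, hd, Or.inl ⟨j, fun z hz => ?_⟩⟩
    rw [hfd z hz, hrone]
    simp [hX]
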